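/- Let $X\in\mathbb{R}^{d\times n}$ ($n\ge 1$) have rank $n$, with thin singular value decomposition $X=U\Sigma V^T$ ($U\in\mathbb{R}^{d\times n}$ with orthonormal columns, $\Sigma=\mathrm{diag}(\sigma_1\ge\dots\ge\sigma_n>0)$, $V\in\mathbb{R}^{n\times n}$ orthogonal), and let $\kappa_X=\sigma_1/\sigma_n$. Let $y\in\mathbb{R}^n$, $\lambda>0$, $\epsilon\in(0,1/2]$, and let $r\ge 9n/\epsilon^2$ be an integer (so $r=O(n/\epsilon^2)$ is possible, e.g. $r=\lceil 9n/\epsilon^2\rceil$). **BSS.** Let $u_1,\dots,u_d\in\mathbb{R}^n$ be the rows of $U$. For a symmetric $A\in\mathbb{R}^{n\times n}$ with eigenvalues $\lambda_i$ put $\Phi(L,A)=\sum_i\frac1{\lambda_i-L}$, $\hat\Phi(B,A)=\sum_i\frac1{B-\lambda_i}$, $$\mathcal{L}(u,\delta,A,L)=\frac{u^T(A-(L+\delta)I)^{-2}u}{\Phi(L+\delta,A)-\Phi(L,A)}-u^T(A-(L+\delta)I)^{-1}u,$$ $$\mathcal{U}(u,\delta,A,B)=\frac{u^T((B+\delta)I-A)^{-2}u}{\hat\Phi(B,A)-\hat\Phi(B+\delta,A)}+u^T((B+\delta)I-A)^{-1}u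 .$$ Let $\delta_L=1$, $\delta_U=\frac{1+\sqrt{n/r}}{1-\sqrt{n/r}}$, $L_\tau=\tau-\sqrt{rn}$, $U_\tau=\delta_U(\tau+\sqrt{nr})$, $A_0=0$. For $\tau=0,\dots,r-1$ the algorithm picks any index $i_\tau$ with $\mathcal{U}_\tau:=\mathcal{U}(u_{i_\tau},\delta_U,A_\tau,U_\tau)\le\mathcal{L}_\tau:=\mathcal{L}(u_{i_\tau},\delta_L,A_\tau,L_\tau)$ for which there is a number $t_\tau>0$ with $t_\tau^{-1}=\frac12(\mathcal{U}_\tau+\mathcal{L}_\tau)$, and sets $A_{\tau+1}=A_\tau+t_\tau u_{i_\tau}u_{i_\tau}^T$. It returns the matrix $R\in\mathbb{R}^{r\times d}$ whose row number $\tau$ has the single nonzero entry $\sqrt{t_\tau}\sqrt{r^{-1}(1-\sqrt{n/r})}$, in column $i_\tau$. **RLSC.** Let $x_{opt}$ minimize $\|Kx-y\|_2^2+\lambda x^TKx$ over $x\in\mathbb{R}^n$, where $K=X^TX$. Let $\tilde X=RX$, and let $\tilde x_{opt}$ minimize $\|\tilde Kx-y\|_2^2+\lambda x^T\tilde Kx$,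 where $\tilde K=\tilde X^T\tilde X$. **Claim.** Let $q=X\alpha$ with $\alpha\in\mathbb{R}^n$, let $\tilde q=Rq$, and assume that for some constant $\omega$ $$\|(I+\lambda\Sigma^{-2})^{-1}V^T\alpha\|_2\,\|V^Ty\|_2\le\omega\,\bigl|\bigl((I+\lambda\Sigma^{-2})^{-1}V^T\alpha\bigr)^TV^Ty\bigr| .$$ Then the algorithm always finds an admissible index, in each of its $r$ iterations; both minimizers exist and are unique; and for every run of the algorithm the right-hand side of the assumption equals $\omega\,|q^TXx_{opt}|$, and $$\bigl|\tilde q^T\tilde X\tilde x_{opt}-q^TXx_{opt}\bigr|\le 2\epsilon\,\omega\,\kappa_X\,|q^TXx_{opt}| .$$ -/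

import Mathlib

namespace RLSC

open Matrix

noncomputable section

/-- The Euclidean norm of a real vector. -/
def l2norm {m : ℕ} (v : Fin m → ℝ) : ℝ := ‖WithLp.toLp 2 v‖

/-- `X = U Σ Vᵀ` is a thin singular value decomposition of the `d × n` matrix `X`:
`U` has orthonormal columns, `V` is orthogonal, `Σ = diag σ` with `σ` nonnegative and
nonincreasing. -/
structure IsThinSVD {d n : ℕ} (X : Matrix (Fin d) (Fin n) ℝ) (U : Matrix (Fin d) (Fin n) ℝ)
    (σ : Fin n → ℝ) (V : Matrix (Fin n) (Fin n) ℝ) : Prop where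
  left_orthonormal : Uᵀ * U = 1
  right_orthonormal : Vᵀ * V = 1
  nonneg : ∀ i, 0 ≤ σ i
  antitone : Antitone σ
  factor : X = U * diagonal σ * Vᵀ

/-- The condition number `σ_max / σ_min` of a matrix with singular values `σ`. -/
def condNumber {n : ℕ} (σ : Fin n → ℝ) : ℝ := (⨆ i, σ i) / (⨅ i, σ i)

/-! ### Regularized least squares classification -/

/-- The objective `‖K x - y‖² + lam xᵀ K x` with the linear kernel `K = Xᵀ X`. -/
def rlscObjective {d n : ℕ} (lam : ℝ) (X : Matrix (Fin d) (Fin n) ℝ) (y x : Fin n → ℝ) : ℝ :=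
  l2norm ((Xᵀ * X) *ᵥ x - y) ^ 2 + lam * (x ⬝ᵥ ((Xᵀ * X) *ᵥ x))

/-- `x` is an optimal solution of the regularized least squares problem for the data `X`. -/
def IsRLSCSolution {d n : ℕ} (lam : ℝ) (X : Matrix (Fin d) (Fin n) ℝ) (y x : Fin n → ℝ) : Prop :=
  ∀ z : Fin n → ℝ, rlscObjective lam X y x ≤ rlscObjective lam X y z

/-- The value `qᵀ X x` that the classification function with coefficients `x`, trained on `X`,
takes at the point `q`. -/
def prediction {d n : ℕ} (X : Matrix (Fin d) (Fin n) ℝ) (x : Fin n → ℝ) (q : Fin d → ℝ) : ℝ :=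
  q ⬝ᵥ (X *ᵥ x)

/-! ### Single-set spectral sparsification (BSS) -/

/-- The lower potential `∑ 1 / (λᵢ - L)`, where the `λᵢ` are the eigenvalues of `A`, counted with
multiplicity. -/
def lowerPotential {l : ℕ} (L : ℝ) (A : Matrix (Fin l) (Fin l) ℝ) : ℝ :=
  (A.charpoly.roots.map fun x => 1 / (x - L)).sum

/-- The upper potential `∑ 1 / (B - λᵢ)`, where the `λᵢ` are the eigenvalues of `A`, counted with
multiplicity. -/
def upperPotential {l : ℕ} (B : ℝ) (A : Matrix (Fin l) (Fin l) ℝ) : ℝ :=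
  (A.charpoly.roots.map fun x => 1 / (B - x)).sum

/-- The function `ℒ(u, δ, A, L)`. -/
def lowerFun {l : ℕ} (u : Fin l → ℝ) (δ : ℝ) (A : Matrix (Fin l) (Fin l) ℝ) (L : ℝ) : ℝ :=
  (u ⬝ᵥ (((A - (L + δ) • (1 : Matrix (Fin l) (Fin l) ℝ))⁻¹ ^ 2) *ᵥ u)) /
      (lowerPotential (L + δ) A - lowerPotential L A)
    - u ⬝ᵥ ((A - (L + δ) • (1 : Matrix (Fin l) (Fin l) ℝ))⁻¹ *ᵥ u)

/-- The function `𝒰(u, δ, A, B)`. -/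
def upperFun {l : ℕ} (u : Fin l → ℝ) (δ : ℝ) (A : Matrix (Fin l) (Fin l) ℝ) (B : ℝ) : ℝ :=
  (u ⬝ᵥ ((((B + δ) • (1 : Matrix (Fin l) (Fin l) ℝ) - A)⁻¹ ^ 2) *ᵥ u)) /
      (upperPotential B A - upperPotential (B + δ) A)
    + u ⬝ᵥ (((B + δ) • (1 : Matrix (Fin l) (Fin l) ℝ) - A)⁻¹ *ᵥ u)

/-- The constant `δ_U = (1 + √(l/r)) / (1 - √(l/r))`. -/
def deltaU (l r : ℕ) : ℝ :=
  (1 + Real.sqrt ((l : ℝ) / r)) / (1 - Real.sqrt ((l : ℝ) / r))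

/-- The lower barrier `L_τ = τ - √(r l)`. -/
def barrierL (l r τ : ℕ) : ℝ := (τ : ℝ) - Real.sqrt ((r : ℝ) * l)

/-- The upper barrier `U_τ = δ_U (τ + √(l r))`. -/
def barrierU (l r τ : ℕ) : ℝ := deltaU l r * ((τ : ℝ) + Real.sqrt ((l : ℝ) * r))

/-- `𝒰` at iteration `τ`, for the `i`-th row of `U`. -/
def stepUpper {d l : ℕ} (U : Matrix (Fin d) (Fin l) ℝ) (r τ : ℕ)
    (A : Matrix (Fin l) (Fin l) ℝ) (i : Fin d) : ℝ :=
  upperFun (U i) (deltaU l r) A (barrierU l r τ)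

/-- `ℒ` at iteration `τ`, for the `i`-th row of `U`, with `δ_L = 1`. -/
def stepLower {d l : ℕ} (U : Matrix (Fin d) (Fin l) ℝ) (r τ : ℕ)
    (A : Matrix (Fin l) (Fin l) ℝ) (i : Fin d) : ℝ :=
  lowerFun (U i) 1 A (barrierL l r τ)

/-- At iteration `τ`, with current matrix `A`, the algorithm may pick the index `i` with the
weight `t > 0`. (In particular the `i`-th row of `U` is nonzero.) -/
structure IsBSSChoice {d l : ℕ} (U : Matrix (Fin d) (Fin l) ℝ) (r τ : ℕ)
    (A : Matrix (Fin l) (Fin l) ℝ) (i : Fin d) (t : ℝ) : Prop where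
  weight_pos : 0 < t
  upper_le_lower : stepUpper U r τ A i ≤ stepLower U r τ A i
  weight_inv : t⁻¹ = (1 / 2) * (stepUpper U r τ A i + stepLower U r τ A i)

/-- `A, i, t` record the first `k` iterations of a run of the algorithm with parameter `r` on the
rows of `U`: the matrices `A_0 = 0, …, A_k`, the indices `i_0, …, i_{k-1}` and the weights
`t_0, …, t_{k-1}`. The values beyond these are irrelevant. Any admissible way of choosing among
several possible indices is allowed. -/
structure IsBSSRun {d l : ℕ} (U : Matrix (Fin d) (Fin l) ℝ) (r k : ℕ)
    (A : ℕ → Matrix (Fin l) (Fin l) ℝ) (i : ℕ → Fin d) (t : ℕ → ℝ) : Prop where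
  init : A 0 = 0
  choice : ∀ τ < k, IsBSSChoice U r τ (A τ) (i τ) (t τ)
  update : ∀ τ < k, A (τ + 1) = A τ + t τ • vecMulVec (U (i τ)) (U (i τ))

/-- The `r × d` sampling matrix `S`: row `τ` is the indicator of the index `i_τ`. -/
def samplingMatrix {d : ℕ} (r : ℕ) (i : ℕ → Fin d) : Matrix (Fin r) (Fin d) ℝ :=
  Matrix.of fun τ j => if j = i τ then 1 else 0

/-- The `r × r` rescaling matrix `D`, with entries `√t_τ` times `√(r⁻¹ (1 - √(l/r)))`. -/
def rescalingMatrix (l r : ℕ) (t : ℕ → ℝ) : Matrix (Fin r) (Fin r) ℝ :=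
  diagonal fun τ =>
    Real.sqrt (t τ) * Real.sqrt ((r : ℝ)⁻¹ * (1 - Real.sqrt ((l : ℝ) / r)))

/-- The matrix `R = D S` returned by the algorithm. -/
def bssMatrix {d : ℕ} (l r : ℕ) (i : ℕ → Fin d) (t : ℕ → ℝ) : Matrix (Fin r) (Fin d) ℝ :=
  rescalingMatrix l r t * samplingMatrix r i

end

end RLSC

namespace RLSC
open Matrix

/-! ### Spectral formulas for resolvents -/

section Spectral

variable {n : ℕ} {A : Matrix (Fin n) (Fin n) ℝ}

/-! Write `s = √(n/r)`, `M = (RU)ᵀ(RU)`, `a = Vᵀα`, `b = Vᵀy`. In the coordinates `ξ = Vᵀx` the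
normal equations become `(Σ² + λ)ξ = b` for the full data and `(ΣMΣ + λ)ξ' = b` for the sampled
data. Subtracting them shows that the difference of predictions is exactly `(Σ⁻¹w)ᵀ(M - 1)(λΣξ')`
(`perturbation_eq`). Here `‖Σ⁻¹w‖ ≤ ‖w‖/σ_n`, and `λ‖ξ'‖ ≤ ‖b‖` because `M` is positive
semidefinite, so the error is at most `‖M - 1‖ κ_X ‖w‖‖b‖`. Moreover `w ⬝ b` is the full prediction
itself, so the assumption on `ω` turns this into a relative error bound.

It remains to prove `(1-s)² ≤ M ≤ (1+s)²`, which is the barrier argument. The spectrum of `A_τ`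
stays strictly between two moving barriers, and neither potential ever exceeds its initial value.
Since the rows satisfy `∑ uᵢuᵢᵀ = I`, summing `𝒰` and `ℒ` over the rows gives traces of resolvents.
These yield `∑ 𝒰 ≤ 1 - s ≤ ∑ ℒ`, so an admissible row exists (`BarrierInvariant.exists_choice`). The
Sherman–Morrison formula shows that a weight with `𝒰 ≤ t⁻¹ ≤ ℒ` preserves both barriers and both
potential bounds (`BarrierInvariant.step`). -/

theorem sub_smul_one_eq_conj (hA : A.IsHermitian) (c : ℝ) :
    A - c • (1 : Matrix (Fin n) (Fin n) ℝ) =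
      (hA.eigenvectorUnitary : Matrix (Fin n) (Fin n) ℝ) *
        diagonal (fun i => hA.eigenvalues i - c) *
        star (hA.eigenvectorUnitary : Matrix (Fin n) (Fin n) ℝ) := by
  have h := hA.spectral_theorem
  rw [Unitary.conjStarAlgAut_apply] at h
  have hd : diagonal (fun i => hA.eigenvalues i - c) =
      diagonal (RCLike.ofReal ∘ hA.eigenvalues) - c • (1 : Matrix (Fin n) (Fin n) ℝ) := by
    ext i j
    by_cases hij : i = j <;> simp [hij]
  rw [hd, Matrix.mul_sub, Matrix.sub_mul, ← h, Matrix.mul_smul, Matrix.mul_one, Matrix.smul_mul]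
  congr 2
  exact (Unitary.coe_mul_star_self hA.eigenvectorUnitary).symm

theorem posDef_sub_smul_one_iff (hA : A.IsHermitian) (c : ℝ) :
    (A - c • (1 : Matrix (Fin n) (Fin n) ℝ)).PosDef ↔ ∀ i, c < hA.eigenvalues i := by
  rw [sub_smul_one_eq_conj hA, (Unitary.isUnit_coe).posDef_star_right_conjugate_iff,
    posDef_diagonal_iff]
  simp

theorem posDef_smul_one_sub_iff (hA : A.IsHermitian) (c : ℝ) :
    (c • (1 : Matrix (Fin n) (Fin n) ℝ) - A).PosDef ↔ ∀ i, hA.eigenvalues i < c := by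
  have h : c • (1 : Matrix (Fin n) (Fin n) ℝ) - A =
      (hA.eigenvectorUnitary : Matrix (Fin n) (Fin n) ℝ) *
        diagonal (fun i => c - hA.eigenvalues i) *
        star (hA.eigenvectorUnitary : Matrix (Fin n) (Fin n) ℝ) := by
    have hd : diagonal (fun i => c - hA.eigenvalues i) =
        -diagonal (fun i => hA.eigenvalues i - c) := by
      ext i j
      by_cases hij : i = j <;> simp [hij]
    rw [hd, Matrix.mul_neg, Matrix.neg_mul, ← sub_smul_one_eq_conj hA, neg_sub]
  rw [h, (Unitary.isUnit_coe).posDef_star_right_conjugate_iff, posDef_diagonal_iff]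
  simp

theorem inv_sub_smul_one_eq_conj (hA : A.IsHermitian) {c : ℝ} (hc : ∀ i, hA.eigenvalues i ≠ c) :
    (A - c • (1 : Matrix (Fin n) (Fin n) ℝ))⁻¹ =
      (hA.eigenvectorUnitary : Matrix (Fin n) (Fin n) ℝ) *
        diagonal (fun i => (hA.eigenvalues i - c)⁻¹) *
        star (hA.eigenvectorUnitary : Matrix (Fin n) (Fin n) ℝ) := by
  apply inv_eq_right_inv
  rw [sub_smul_one_eq_conj hA]
  set P := (hA.eigenvectorUnitary : Matrix (Fin n) (Fin n) ℝ)
  have h1 : star P * P = 1 := Unitary.coe_star_mul_self hA.eigenvectorUnitary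
  have h2 : P * star P = 1 := Unitary.coe_mul_star_self hA.eigenvectorUnitary
  calc _ = P * diagonal (fun i => hA.eigenvalues i - c) * (star P * P) *
        diagonal (fun i => (hA.eigenvalues i - c)⁻¹) * star P := by simp only [Matrix.mul_assoc]
    _ = P * (diagonal (fun i => hA.eigenvalues i - c) *
        diagonal (fun i => (hA.eigenvalues i - c)⁻¹)) * star P := by
          rw [h1, Matrix.mul_one]; simp only [Matrix.mul_assoc]
    _ = 1 := by
      rw [diagonal_mul_diagonal]
      have : (fun i => (hA.eigenvalues i - c) * (hA.eigenvalues i - c)⁻¹) = fun _ => 1 := by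
        ext i; exact mul_inv_cancel₀ (sub_ne_zero.2 (hc i))
      rw [this, diagonal_one, Matrix.mul_one, h2]

theorem trace_inv_sub_smul_one (hA : A.IsHermitian) {c : ℝ} (hc : ∀ i, hA.eigenvalues i ≠ c) :
    trace ((A - c • (1 : Matrix (Fin n) (Fin n) ℝ))⁻¹) = ∑ i, 1 / (hA.eigenvalues i - c) := by
  rw [inv_sub_smul_one_eq_conj hA hc, trace_mul_cycle, Unitary.coe_star_mul_self, Matrix.one_mul,
    trace_diagonal]
  simp

theorem trace_inv_sub_smul_one_sq (hA : A.IsHermitian) {c : ℝ}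
    (hc : ∀ i, hA.eigenvalues i ≠ c) :
    trace ((A - c • (1 : Matrix (Fin n) (Fin n) ℝ))⁻¹ ^ 2) =
      ∑ i, 1 / (hA.eigenvalues i - c) ^ 2 := by
  rw [inv_sub_smul_one_eq_conj hA hc]
  set P := (hA.eigenvectorUnitary : Matrix (Fin n) (Fin n) ℝ)
  have h1 : star P * P = 1 := Unitary.coe_star_mul_self hA.eigenvectorUnitary
  set D := diagonal (fun i => (hA.eigenvalues i - c)⁻¹)
  have : (P * D * star P) ^ 2 = P * (D * D) * star P := by
    rw [pow_two]
    calc _ = P * D * (star P * P) * D * star P := by simp only [Matrix.mul_assoc]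
      _ = _ := by rw [h1, Matrix.mul_one]; simp only [Matrix.mul_assoc]
  rw [this, trace_mul_cycle, h1, Matrix.one_mul, diagonal_mul_diagonal, trace_diagonal]
  simp [pow_two]

theorem inv_smul_one_sub (A : Matrix (Fin n) (Fin n) ℝ) (c : ℝ) :
    (c • (1 : Matrix (Fin n) (Fin n) ℝ) - A)⁻¹ =
      -(A - c • (1 : Matrix (Fin n) (Fin n) ℝ))⁻¹ := by
  rw [← neg_sub]
  by_cases h : IsUnit (A - c • (1 : Matrix (Fin n) (Fin n) ℝ)).det
  · apply inv_eq_right_inv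
    rw [neg_mul_neg, mul_nonsing_inv _ h]
  · rw [nonsing_inv_apply_not_isUnit _ h, nonsing_inv_apply_not_isUnit, neg_zero]
    rwa [← isUnit_iff_isUnit_det, IsUnit.neg_iff, isUnit_iff_isUnit_det]

theorem trace_inv_smul_one_sub (hA : A.IsHermitian) {c : ℝ} (hc : ∀ i, hA.eigenvalues i ≠ c) :
    trace ((c • (1 : Matrix (Fin n) (Fin n) ℝ) - A)⁻¹) = ∑ i, 1 / (c - hA.eigenvalues i) := by
  rw [inv_smul_one_sub, trace_neg, trace_inv_sub_smul_one hA hc, ← Finset.sum_neg_distrib]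
  refine Finset.sum_congr rfl fun i _ => ?_
  rw [← neg_sub c, one_div_neg_eq_neg_one_div, neg_neg]

theorem trace_inv_smul_one_sub_sq (hA : A.IsHermitian) {c : ℝ}
    (hc : ∀ i, hA.eigenvalues i ≠ c) :
    trace ((c • (1 : Matrix (Fin n) (Fin n) ℝ) - A)⁻¹ ^ 2) =
      ∑ i, 1 / (c - hA.eigenvalues i) ^ 2 := by
  rw [inv_smul_one_sub, neg_sq, trace_inv_sub_smul_one_sq hA hc]
  refine Finset.sum_congr rfl fun i _ => ?_
  rw [← neg_sub c, neg_sq]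

theorem lowerPotential_eq_sum (hA : A.IsHermitian) (L : ℝ) :
    lowerPotential L A = ∑ i, 1 / (hA.eigenvalues i - L) := by
  rw [lowerPotential, hA.roots_charpoly_eq_eigenvalues, Multiset.map_map]
  rfl

theorem upperPotential_eq_sum (hA : A.IsHermitian) (B : ℝ) :
    upperPotential B A = ∑ i, 1 / (B - hA.eigenvalues i) := by
  rw [upperPotential, hA.roots_charpoly_eq_eigenvalues, Multiset.map_map]
  rfl

theorem lowerPotential_eq_trace (hA : A.IsHermitian) {L : ℝ}
    (hL : (A - L • (1 : Matrix (Fin n) (Fin n) ℝ)).PosDef) :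
    lowerPotential L A = trace ((A - L • (1 : Matrix (Fin n) (Fin n) ℝ))⁻¹) := by
  rw [lowerPotential_eq_sum hA,
    trace_inv_sub_smul_one hA fun i => ((posDef_sub_smul_one_iff hA L).1 hL i).ne']

theorem upperPotential_eq_trace (hA : A.IsHermitian) {B : ℝ}
    (hB : (B • (1 : Matrix (Fin n) (Fin n) ℝ) - A).PosDef) :
    upperPotential B A = trace ((B • (1 : Matrix (Fin n) (Fin n) ℝ) - A)⁻¹) := by
  rw [upperPotential_eq_sum hA,
    trace_inv_smul_one_sub hA fun i => ((posDef_smul_one_sub_iff hA B).1 hB i).ne]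

end Spectral

/-! ### Rank-one updates -/

section RankOne

variable {n : ℕ}

theorem isHermitian_smul_vecMulVec_self (t : ℝ) (u : Fin n → ℝ) :
    (t • vecMulVec u u).IsHermitian := by
  ext i j
  simp [vecMulVec_apply, mul_comm]

theorem dotProduct_vecMulVec_self_mulVec (u x : Fin n → ℝ) :
    x ⬝ᵥ (vecMulVec u u *ᵥ x) = (u ⬝ᵥ x) ^ 2 := by
  rw [vecMulVec_mulVec, dotProduct_smul, dotProduct_comm x u]
  simp [pow_two]

theorem dotProduct_mulVec_comm_of_isHermitian {M : Matrix (Fin n) (Fin n) ℝ}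
    (hM : M.IsHermitian) (x y : Fin n → ℝ) : x ⬝ᵥ (M *ᵥ y) = y ⬝ᵥ (M *ᵥ x) := by
  have h : Mᵀ = M := by simpa using hM.eq
  rw [dotProduct_mulVec, ← mulVec_transpose, h, dotProduct_comm]

theorem dotProduct_sq_mulVec {M : Matrix (Fin n) (Fin n) ℝ} (hM : M.IsHermitian)
    (u : Fin n → ℝ) : u ⬝ᵥ ((M ^ 2) *ᵥ u) = (M *ᵥ u) ⬝ᵥ (M *ᵥ u) := by
  rw [pow_two, ← mulVec_mulVec, dotProduct_mulVec_comm_of_isHermitian hM]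

/-- The Sherman–Morrison formula. -/
theorem inv_add_smul_vecMulVec_self {M : Matrix (Fin n) (Fin n) ℝ} (hM : M.IsHermitian)
    (hu : IsUnit M) (u : Fin n → ℝ) (t : ℝ) (ht : 1 + t * (u ⬝ᵥ (M⁻¹ *ᵥ u)) ≠ 0) :
    (M + t • vecMulVec u u)⁻¹ = M⁻¹ -
      (t / (1 + t * (u ⬝ᵥ (M⁻¹ *ᵥ u)))) • vecMulVec (M⁻¹ *ᵥ u) (M⁻¹ *ᵥ u) := by
  apply inv_eq_right_inv
  have hdet : IsUnit M.det := (isUnit_iff_isUnit_det M).1 hu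
  have hMt : Mᵀ = M := by simpa using hM.eq
  set z := M⁻¹ *ᵥ u with hz
  have hMz : M *ᵥ z = u := by rw [hz, mulVec_mulVec, mul_nonsing_inv _ hdet, one_mulVec]
  have h1 : vecMulVec u u * M⁻¹ = vecMulVec u z := by
    rw [vecMulVec_mul, ← mulVec_transpose, transpose_nonsing_inv, hMt]
  have h2 : M * vecMulVec z z = vecMulVec u z := by rw [mul_vecMulVec, hMz]
  have h3 : vecMulVec u u * vecMulVec z z = (u ⬝ᵥ z) • vecMulVec u z := by
    rw [vecMulVec_mul_vecMulVec, vecMulVec_smul]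
  rw [Matrix.add_mul, Matrix.mul_sub, Matrix.mul_sub, mul_nonsing_inv _ hdet, Matrix.mul_smul, h2,
    Matrix.smul_mul, h1, Matrix.smul_mul, Matrix.mul_smul, h3]
  set c := u ⬝ᵥ z
  have h4 : t - t / (1 + t * c) - t * (t / (1 + t * c) * c) = 0 := by field_simp; ring
  calc _ = 1 + (t - t / (1 + t * c) - t * (t / (1 + t * c) * c)) • vecMulVec u z := by module
    _ = 1 := by rw [h4, zero_smul, add_zero]

theorem trace_inv_add_smul_vecMulVec_self {M : Matrix (Fin n) (Fin n) ℝ} (hM : M.IsHermitian)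
    (hu : IsUnit M) (u : Fin n → ℝ) (t : ℝ) (ht : 1 + t * (u ⬝ᵥ (M⁻¹ *ᵥ u)) ≠ 0) :
    trace ((M + t • vecMulVec u u)⁻¹) = trace M⁻¹ -
      t / (1 + t * (u ⬝ᵥ (M⁻¹ *ᵥ u))) * (u ⬝ᵥ ((M⁻¹ ^ 2) *ᵥ u)) := by
  rw [inv_add_smul_vecMulVec_self hM hu u t ht, trace_sub, trace_smul, trace_vecMulVec,
    dotProduct_sq_mulVec hM.inv, smul_eq_mul]

/-- With `z = M⁻¹u`, nonnegativity of the form of `M` at `x - t(u ⬝ x)z` gives `xᵀMx - t(u ⬝ x)² ≥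
t(u ⬝ x)²(1 - t(u ⬝ z))`. This settles the case `u ⬝ x ≠ 0`; otherwise the rank-one term vanishes at
`x`. -/
theorem posDef_sub_smul_vecMulVec_self {M : Matrix (Fin n) (Fin n) ℝ} (hM : M.PosDef)
    (u : Fin n → ℝ) {t : ℝ} (ht : 0 < t) (htu : t * (u ⬝ᵥ (M⁻¹ *ᵥ u)) < 1) :
    (M - t • vecMulVec u u).PosDef := by
  refine PosDef.of_dotProduct_mulVec_pos
    (hM.isHermitian.sub (isHermitian_smul_vecMulVec_self t u)) fun x hx => ?_
  have hdet : IsUnit M.det := (isUnit_iff_isUnit_det M).1 hM.isUnit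
  have hpos := hM.dotProduct_mulVec_pos hx
  simp only [star_trivial] at hpos ⊢
  rw [sub_mulVec, dotProduct_sub, smul_mulVec, dotProduct_smul, dotProduct_vecMulVec_self_mulVec,
    smul_eq_mul]
  set z := M⁻¹ *ᵥ u with hz
  have hMz : M *ᵥ z = u := by rw [hz, mulVec_mulVec, mul_nonsing_inv _ hdet, one_mulVec]
  have h := hM.posSemidef.dotProduct_mulVec_nonneg (x - (t * (u ⬝ᵥ x)) • z)
  simp only [star_trivial, mulVec_sub, mulVec_smul, hMz, sub_dotProduct, dotProduct_sub,
    smul_dotProduct, dotProduct_smul, smul_eq_mul] at h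
  rw [dotProduct_mulVec_comm_of_isHermitian hM.isHermitian z x, hMz, dotProduct_comm z u,
    dotProduct_comm x u] at h
  by_cases h0 : u ⬝ᵥ x = 0
  · rw [h0]; simpa using hpos
  · have : 0 < t * (u ⬝ᵥ x) ^ 2 * (1 - t * (u ⬝ᵥ z)) := by
      have : 0 < (u ⬝ᵥ x) ^ 2 := by positivity
      have : 0 < 1 - t * (u ⬝ᵥ z) := by linarith
      positivity
    nlinarith

/-- The rows resolve the identity, `∑ uᵢuᵢᵀ = UᵀU = I`. Sums of resolvent forms over the rows thus
become traces, comparable with the potentials. -/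
theorem sum_dotProduct_mulVec_row {d : ℕ} {U : Matrix (Fin d) (Fin n) ℝ} (hU : Uᵀ * U = 1)
    (M : Matrix (Fin n) (Fin n) ℝ) : ∑ i, U i ⬝ᵥ (M *ᵥ U i) = trace M := by
  calc _ = trace (U * M * Uᵀ) := by
        simp only [trace, diag_apply, mul_apply_eq_vecMul, dotProduct_mulVec]
        rfl
    _ = trace M := by rw [trace_mul_cycle, hU, Matrix.one_mul]

end RankOne

/-! ### Barrier potentials: averaging and update -/

section Barrier

variable {n : ℕ}

/-- Here `a i` stands for `λᵢ - (L + δ)`. The potential difference is `δP` and `∑ 1/a² = P + δQ`, so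
the quotient is `1/δ + Q/P` and the claim reduces to `δP² ≤ Q`. Cauchy–Schwarz gives `P² ≤ Q ∑ 1/(a
+ δ)`, and the last sum is at most `1/δ`. -/
theorem lower_average_inequality (hn : 0 < n) {a : Fin n → ℝ} {δ : ℝ} (hδ : 0 < δ)
    (ha : ∀ i, 0 < a i) (h : ∑ i, 1 / (a i + δ) ≤ 1 / δ) :
    1 / δ - ∑ i, 1 / (a i + δ) ≤
      (∑ i, 1 / a i ^ 2) / (∑ i, 1 / a i - ∑ i, 1 / (a i + δ)) - ∑ i, 1 / a i := by
  have : Nonempty (Fin n) := ⟨⟨0, hn⟩⟩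
  set P := ∑ i, 1 / (a i * (a i + δ)) with hP
  set Q := ∑ i, 1 / (a i ^ 2 * (a i + δ)) with hQ
  have haδ : ∀ i, 0 < a i + δ := fun i => add_pos (ha i) hδ
  have hPpos : 0 < P := Finset.sum_pos
    (fun i _ => one_div_pos.2 (mul_pos (ha i) (haδ i))) Finset.univ_nonempty
  have hQ0 : 0 ≤ Q := Finset.sum_nonneg fun i _ =>
    one_div_nonneg.2 (mul_nonneg (sq_nonneg _) (haδ i).le)
  have h1 : ∑ i, 1 / a i - ∑ i, 1 / (a i + δ) = δ * P := by
    rw [hP, Finset.mul_sum, ← Finset.sum_sub_distrib]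
    refine Finset.sum_congr rfl fun i _ => ?_
    have := (ha i).ne'; have := (haδ i).ne'
    field_simp; ring
  have h2 : ∑ i, 1 / a i ^ 2 = P + δ * Q := by
    rw [hP, hQ, Finset.mul_sum, ← Finset.sum_add_distrib]
    refine Finset.sum_congr rfl fun i _ => ?_
    have := (ha i).ne'; have := (haδ i).ne'
    field_simp
  have h3 : P ^ 2 ≤ Q * ∑ i, 1 / (a i + δ) := by
    refine Finset.sum_sq_le_sum_mul_sum_of_sq_le_mul _
      (fun i _ => one_div_nonneg.2 (mul_nonneg (sq_nonneg _) (haδ i).le))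
      (fun i _ => one_div_nonneg.2 (haδ i).le) fun i _ => le_of_eq ?_
    have := (ha i).ne'; have := (haδ i).ne'
    field_simp
  have h4 : δ * P ^ 2 ≤ Q := by
    have : Q * ∑ i, 1 / (a i + δ) ≤ Q * (1 / δ) := mul_le_mul_of_nonneg_left h hQ0
    have h5 : P ^ 2 ≤ Q / δ := by rw [div_eq_mul_one_div]; linarith
    rwa [le_div_iff₀ hδ, mul_comm] at h5
  have h6 : (∑ i, 1 / a i ^ 2) / (δ * P) = 1 / δ + Q / P := by
    rw [h2]; field_simp
  have h7 : δ * P ≤ Q / P := by rw [le_div_iff₀ hPpos]; nlinarith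
  rw [h1, h6]
  linarith

/-- Termwise `1/(b + δ)² ≤ 1/(b(b + δ))`, and the right-hand terms sum to `1/δ` times the potential
drop. So the quotient is at most `1/δ`. -/
theorem upper_average_inequality (hn : 0 < n) {b : Fin n → ℝ} {δ : ℝ} (hδ : 0 < δ)
    (hb : ∀ i, 0 < b i) :
    (∑ i, 1 / (b i + δ) ^ 2) / (∑ i, 1 / b i - ∑ i, 1 / (b i + δ)) + ∑ i, 1 / (b i + δ) ≤
      1 / δ + ∑ i, 1 / b i := by
  have : Nonempty (Fin n) := ⟨⟨0, hn⟩⟩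
  set P := ∑ i, 1 / (b i * (b i + δ)) with hP
  have hbδ : ∀ i, 0 < b i + δ := fun i => add_pos (hb i) hδ
  have hPpos : 0 < P := Finset.sum_pos
    (fun i _ => one_div_pos.2 (mul_pos (hb i) (hbδ i))) Finset.univ_nonempty
  have h1 : ∑ i, 1 / b i - ∑ i, 1 / (b i + δ) = δ * P := by
    rw [hP, Finset.mul_sum, ← Finset.sum_sub_distrib]
    refine Finset.sum_congr rfl fun i _ => ?_
    have := (hb i).ne'; have := (hbδ i).ne'
    field_simp; ring
  have h2 : ∑ i, 1 / (b i + δ) ^ 2 ≤ P := by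
    refine Finset.sum_le_sum fun i _ => ?_
    refine one_div_le_one_div_of_le (mul_pos (hb i) (hbδ i)) ?_
    have := hb i
    nlinarith
  have h3 : (∑ i, 1 / (b i + δ) ^ 2) / (δ * P) ≤ 1 / δ := by
    rw [div_le_div_iff₀ (mul_pos hδ hPpos) hδ]
    nlinarith
  have h4 : 0 ≤ δ * P := by positivity
  rw [h1]
  linarith

variable {A : Matrix (Fin n) (Fin n) ℝ}

/-- All terms of the potential are positive, so each `1/(λᵢ - L)` is below `1/δ`: every eigenvalue
clears the barrier by more than the shift. -/
theorem posDef_sub_add_smul_one (hA : A.IsHermitian) {L δ : ℝ}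
    (hL : (A - L • (1 : Matrix (Fin n) (Fin n) ℝ)).PosDef) (h : lowerPotential L A < 1 / δ) :
    (A - (L + δ) • (1 : Matrix (Fin n) (Fin n) ℝ)).PosDef := by
  rw [posDef_sub_smul_one_iff hA] at hL ⊢
  intro i
  rw [lowerPotential_eq_sum hA] at h
  have h1 : 1 / (hA.eigenvalues i - L) ≤ ∑ i, 1 / (hA.eigenvalues i - L) :=
    Finset.single_le_sum (f := fun i => 1 / (hA.eigenvalues i - L))
      (fun j _ => one_div_nonneg.2 (sub_pos.2 (hL j)).le) (Finset.mem_univ i)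
  have h2 := lt_of_one_div_lt_one_div (sub_pos.2 (hL i)) (h1.trans_lt h)
  linarith

theorem posDef_add_smul_one_sub (hA : A.IsHermitian) {B δ : ℝ} (hδ : 0 < δ)
    (hB : (B • (1 : Matrix (Fin n) (Fin n) ℝ) - A).PosDef) :
    ((B + δ) • (1 : Matrix (Fin n) (Fin n) ℝ) - A).PosDef := by
  rw [posDef_smul_one_sub_iff hA] at hB ⊢
  exact fun i => (hB i).trans (by linarith)

theorem lowerPotential_lt_add (hn : 0 < n) (hA : A.IsHermitian) {L δ : ℝ} (hδ : 0 < δ)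
    (hL : (A - (L + δ) • (1 : Matrix (Fin n) (Fin n) ℝ)).PosDef) :
    lowerPotential L A < lowerPotential (L + δ) A := by
  have : Nonempty (Fin n) := ⟨⟨0, hn⟩⟩
  rw [posDef_sub_smul_one_iff hA] at hL
  rw [lowerPotential_eq_sum hA, lowerPotential_eq_sum hA]
  refine Finset.sum_lt_sum_of_nonempty Finset.univ_nonempty fun i _ => ?_
  exact one_div_lt_one_div_of_lt (sub_pos.2 (hL i)) (by linarith)

theorem upperPotential_add_lt (hn : 0 < n) (hA : A.IsHermitian) {B δ : ℝ} (hδ : 0 < δ)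
    (hB : (B • (1 : Matrix (Fin n) (Fin n) ℝ) - A).PosDef) :
    upperPotential (B + δ) A < upperPotential B A := by
  have : Nonempty (Fin n) := ⟨⟨0, hn⟩⟩
  rw [posDef_smul_one_sub_iff hA] at hB
  rw [upperPotential_eq_sum hA, upperPotential_eq_sum hA]
  refine Finset.sum_lt_sum_of_nonempty Finset.univ_nonempty fun i _ => ?_
  exact one_div_lt_one_div_of_lt (sub_pos.2 (hB i)) (by linarith)

theorem le_sum_lowerFun {d : ℕ} {U : Matrix (Fin d) (Fin n) ℝ} (hU : Uᵀ * U = 1) (hn : 0 < n)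
    (hA : A.IsHermitian) {L δ : ℝ} (hδ : 0 < δ)
    (hL : (A - L • (1 : Matrix (Fin n) (Fin n) ℝ)).PosDef) (h : lowerPotential L A < 1 / δ) :
    1 / δ - lowerPotential L A ≤ ∑ i, lowerFun (U i) δ A L := by
  have hL' := posDef_sub_add_smul_one hA hL h
  have he := (posDef_sub_smul_one_iff hA _).1 hL'
  have hne : ∀ i, hA.eigenvalues i ≠ L + δ := fun i => (he i).ne'
  simp only [lowerFun, Finset.sum_sub_distrib, ← Finset.sum_div, sum_dotProduct_mulVec_row hU]
  rw [trace_inv_sub_smul_one hA hne, trace_inv_sub_smul_one_sq hA hne, lowerPotential_eq_sum hA,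
    lowerPotential_eq_sum hA]
  rw [lowerPotential_eq_sum hA] at h
  have hs : ∀ i, hA.eigenvalues i - L = (hA.eigenvalues i - (L + δ)) + δ := fun i => by ring
  simp only [hs] at h ⊢
  exact lower_average_inequality hn hδ (fun i => sub_pos.2 (he i)) h.le

theorem sum_upperFun_le {d : ℕ} {U : Matrix (Fin d) (Fin n) ℝ} (hU : Uᵀ * U = 1) (hn : 0 < n)
    (hA : A.IsHermitian) {B δ : ℝ} (hδ : 0 < δ)
    (hB : (B • (1 : Matrix (Fin n) (Fin n) ℝ) - A).PosDef) :
    ∑ i, upperFun (U i) δ A B ≤ 1 / δ + upperPotential B A := by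
  have he := (posDef_smul_one_sub_iff hA _).1 hB
  have hne : ∀ i, hA.eigenvalues i ≠ B + δ := fun i => ((he i).trans (by linarith)).ne
  simp only [upperFun, Finset.sum_add_distrib, ← Finset.sum_div, sum_dotProduct_mulVec_row hU]
  rw [trace_inv_smul_one_sub hA hne, trace_inv_smul_one_sub_sq hA hne, upperPotential_eq_sum hA,
    upperPotential_eq_sum hA]
  have hs : ∀ i, B + δ - hA.eigenvalues i = (B - hA.eigenvalues i) + δ := fun i => by ring
  simp only [hs]
  exact upper_average_inequality hn hδ (fun i => sub_pos.2 (he i))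

/-- The quotient in `upperFun` has numerator `‖N⁻¹u‖² > 0`, where `N = (B + δ)I - A`. The strictness
later gives `t * c < 1`, so the updated spectrum does not touch the upper barrier. -/
theorem lt_upperFun (hn : 0 < n) (hA : A.IsHermitian) {B δ : ℝ} (hδ : 0 < δ)
    (hB : (B • (1 : Matrix (Fin n) (Fin n) ℝ) - A).PosDef) {u : Fin n → ℝ} (hu : u ≠ 0) :
    u ⬝ᵥ (((B + δ) • (1 : Matrix (Fin n) (Fin n) ℝ) - A)⁻¹ *ᵥ u) < upperFun u δ A B := by
  have hN := (posDef_add_smul_one_sub hA hδ hB).inv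
  have h1 := sub_pos.2 (upperPotential_add_lt hn hA hδ hB)
  have h2 : 0 < u ⬝ᵥ ((((B + δ) • (1 : Matrix (Fin n) (Fin n) ℝ) - A)⁻¹ ^ 2) *ᵥ u) := by
    rw [dotProduct_sq_mulVec hN.isHermitian]
    refine lt_of_le_of_ne (Finset.sum_nonneg fun _ _ => mul_self_nonneg _) fun h => ?_
    have h0 := dotProduct_self_eq_zero.1 h.symm
    have := hN.dotProduct_mulVec_pos hu
    rw [h0] at this
    simp at this
  have h3 := div_pos h2 h1
  unfold upperFun
  linarith

theorem upperFun_pos (hn : 0 < n) (hA : A.IsHermitian) {B δ : ℝ} (hδ : 0 < δ)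
    (hB : (B • (1 : Matrix (Fin n) (Fin n) ℝ) - A).PosDef) {u : Fin n → ℝ} (hu : u ≠ 0) :
    0 < upperFun u δ A B := by
  have h := (posDef_add_smul_one_sub hA hδ hB).inv.dotProduct_mulVec_pos hu
  simp only [star_trivial] at h
  exact h.trans (lt_upperFun hn hA hδ hB hu)

theorem posSemidef_smul_vecMulVec_self {t : ℝ} (ht : 0 ≤ t) (u : Fin n → ℝ) :
    (t • vecMulVec u u).PosSemidef := by
  simpa using (posSemidef_vecMulVec_self_star u).smul ht

/-- By Sherman–Morrison the update lowers the potential at `L + δ` by `te/(1 + tc)`. The condition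
on `t⁻¹` says exactly that this compensates the increase caused by moving the barrier. -/
theorem lower_barrier_update (hn : 0 < n) (hA : A.IsHermitian) {L δ t : ℝ} (hδ : 0 < δ)
    (hL : (A - (L + δ) • (1 : Matrix (Fin n) (Fin n) ℝ)).PosDef) (ht : 0 < t) {u : Fin n → ℝ}
    (htu : t⁻¹ ≤ lowerFun u δ A L) :
    (A + t • vecMulVec u u - (L + δ) • (1 : Matrix (Fin n) (Fin n) ℝ)).PosDef ∧
      lowerPotential (L + δ) (A + t • vecMulVec u u) ≤ lowerPotential L A := by
  have heq : A + t • vecMulVec u u - (L + δ) • (1 : Matrix (Fin n) (Fin n) ℝ) =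
    A - (L + δ) • (1 : Matrix (Fin n) (Fin n) ℝ) + t • vecMulVec u u := by abel
  have hpd : (A + t • vecMulVec u u - (L + δ) • (1 : Matrix (Fin n) (Fin n) ℝ)).PosDef := by
    rw [heq]
    exact hL.add_posSemidef (posSemidef_smul_vecMulVec_self ht.le u)
  refine ⟨hpd, ?_⟩
  have hlt := sub_pos.2 (lowerPotential_lt_add hn hA hδ hL)
  have hc := hL.inv.posSemidef.dotProduct_mulVec_nonneg u
  simp only [star_trivial] at hc
  rw [lowerPotential_eq_trace (hA.add (isHermitian_smul_vecMulVec_self t u)) hpd, heq]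
  have h1 : 0 < 1 + t * (u ⬝ᵥ ((A - (L + δ) • (1 : Matrix (Fin n) (Fin n) ℝ))⁻¹ *ᵥ u)) := by
    positivity
  rw [trace_inv_add_smul_vecMulVec_self hL.isHermitian hL.isUnit u t h1.ne',
    ← lowerPotential_eq_trace hA hL]
  unfold lowerFun at htu
  set c := u ⬝ᵥ ((A - (L + δ) • (1 : Matrix (Fin n) (Fin n) ℝ))⁻¹ *ᵥ u)
  set e := u ⬝ᵥ (((A - (L + δ) • (1 : Matrix (Fin n) (Fin n) ℝ))⁻¹ ^ 2) *ᵥ u)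
  have h2 : (t⁻¹ + c) * (lowerPotential (L + δ) A - lowerPotential L A) ≤ e := by
    rw [← le_div_iff₀ hlt]; linarith
  have h3 : lowerPotential (L + δ) A - lowerPotential L A ≤ t / (1 + t * c) * e := by
    rw [div_mul_eq_mul_div, le_div_iff₀ h1]
    calc _ = t * ((t⁻¹ + c) * (lowerPotential (L + δ) A - lowerPotential L A)) := by
          field_simp
      _ ≤ t * e := mul_le_mul_of_nonneg_left h2 ht.le
  linarith

/-- Mirror image of the lower update, with Sherman–Morrison at weight `-t`: the potential rises by
`te/(1 - tc)`, at most what moving the barrier has gained. -/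
theorem upper_barrier_update (hn : 0 < n) (hA : A.IsHermitian) {B δ t : ℝ} (hδ : 0 < δ)
    (hB : (B • (1 : Matrix (Fin n) (Fin n) ℝ) - A).PosDef) (ht : 0 < t) {u : Fin n → ℝ}
    (hu : u ≠ 0) (htu : upperFun u δ A B ≤ t⁻¹) :
    ((B + δ) • (1 : Matrix (Fin n) (Fin n) ℝ) - (A + t • vecMulVec u u)).PosDef ∧
      upperPotential (B + δ) (A + t • vecMulVec u u) ≤ upperPotential B A := by
  have hN := posDef_add_smul_one_sub hA hδ hB
  have hlt := sub_pos.2 (upperPotential_add_lt hn hA hδ hB)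
  have hc := (lt_upperFun hn hA hδ hB hu).trans_le htu
  unfold upperFun at htu
  set c := u ⬝ᵥ (((B + δ) • (1 : Matrix (Fin n) (Fin n) ℝ) - A)⁻¹ *ᵥ u) with hcdef
  set e := u ⬝ᵥ ((((B + δ) • (1 : Matrix (Fin n) (Fin n) ℝ) - A)⁻¹ ^ 2) *ᵥ u) with hedef
  have htc : t * c < 1 := by
    calc t * c < t * t⁻¹ := mul_lt_mul_of_pos_left hc ht
      _ = 1 := mul_inv_cancel₀ ht.ne'
  have heq : (B + δ) • (1 : Matrix (Fin n) (Fin n) ℝ) - (A + t • vecMulVec u u) =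
    (B + δ) • (1 : Matrix (Fin n) (Fin n) ℝ) - A - t • vecMulVec u u := by abel
  have hpd : ((B + δ) • (1 : Matrix (Fin n) (Fin n) ℝ) - (A + t • vecMulVec u u)).PosDef := by
    rw [heq]
    exact posDef_sub_smul_vecMulVec_self hN u ht htc
  refine ⟨hpd, ?_⟩
  have h1 : 0 < 1 + -t * c := by linarith
  rw [upperPotential_eq_trace (hA.add (isHermitian_smul_vecMulVec_self t u)) hpd, heq,
    sub_eq_add_neg, ← neg_smul,
    trace_inv_add_smul_vecMulVec_self hN.isHermitian hN.isUnit u (-t) h1.ne',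
    ← upperPotential_eq_trace hA hN, ← hcdef, ← hedef]
  have h2 : e ≤ (t⁻¹ - c) * (upperPotential B A - upperPotential (B + δ) A) := by
    rw [← div_le_iff₀ hlt]; linarith
  have h3 : t / (1 + -t * c) * e ≤ upperPotential B A - upperPotential (B + δ) A := by
    rw [div_mul_eq_mul_div, div_le_iff₀ h1]
    calc t * e ≤ t * ((t⁻¹ - c) * (upperPotential B A - upperPotential (B + δ) A)) :=
          mul_le_mul_of_nonneg_left h2 ht.le
      _ = _ := by field_simp; ring
  have h4 : -t / (1 + -t * c) * e = -(t / (1 + -t * c) * e) := by ring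
  rw [h4]
  linarith

end Barrier

/-! ### Runs of the algorithm -/

section Run

variable {d n r : ℕ}

/-- The invariant maintained by the barrier argument after `τ` iterations. -/
structure BarrierInvariant (r τ : ℕ) (A : Matrix (Fin n) (Fin n) ℝ) : Prop where
  isHermitian : A.IsHermitian
  lower_posDef : (A - barrierL n r τ • (1 : Matrix (Fin n) (Fin n) ℝ)).PosDef
  upper_posDef : (barrierU n r τ • (1 : Matrix (Fin n) (Fin n) ℝ) - A).PosDef
  lower_le : lowerPotential (barrierL n r τ) A ≤ Real.sqrt ((n : ℝ) / r)
  upper_le : upperPotential (barrierU n r τ) A ≤ Real.sqrt ((n : ℝ) / r) / deltaU n r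

theorem barrierL_succ (τ : ℕ) : barrierL n r (τ + 1) = barrierL n r τ + 1 := by
  simp only [barrierL, Nat.cast_add, Nat.cast_one]; ring

theorem barrierU_succ (τ : ℕ) : barrierU n r (τ + 1) = barrierU n r τ + deltaU n r := by
  simp only [barrierU, Nat.cast_add, Nat.cast_one]; ring

theorem sqrt_mul_eq (r n : ℕ) :
    Real.sqrt ((r : ℝ) * n) = r * Real.sqrt ((n : ℝ) / r) := by
  rcases Nat.eq_zero_or_pos r with rfl | hr
  · simp
  have hr' : (0 : ℝ) < r := by exact_mod_cast hr
  rw [← Real.sqrt_sq hr'.le, ← Real.sqrt_mul (by positivity), Real.sqrt_sq hr'.le]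
  congr 1
  field_simp

theorem sqrt_div_pos (hn : 0 < n) (hr : 0 < r) : 0 < Real.sqrt ((n : ℝ) / r) := by
  apply Real.sqrt_pos.2
  have : (0 : ℝ) < n := by exact_mod_cast hn
  have : (0 : ℝ) < r := by exact_mod_cast hr
  positivity

theorem deltaU_pos (hs : Real.sqrt ((n : ℝ) / r) < 1) : 0 < deltaU n r := by
  have := Real.sqrt_nonneg ((n : ℝ) / r)
  exact div_pos (by linarith) (by linarith)

theorem BarrierInvariant.zero (hn : 0 < n) (hr : 0 < r) (hs : Real.sqrt ((n : ℝ) / r) < 1) :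
    BarrierInvariant r 0 (0 : Matrix (Fin n) (Fin n) ℝ) := by
  have hs0 := sqrt_div_pos hn hr
  have hδ := deltaU_pos hs
  have hr' : (0 : ℝ) < r := by exact_mod_cast hr
  have hsq : Real.sqrt ((n : ℝ) / r) ^ 2 = n / r := Real.sq_sqrt (by positivity)
  have hroots : (0 : Matrix (Fin n) (Fin n) ℝ).charpoly.roots = Multiset.replicate n 0 := by
    simp [charpoly_zero, Multiset.nsmul_singleton]
  -- All eigenvalues of `A_0` are zero and the barriers start at `-rs` and `δ_U rs`, so `n = rs²`
  -- makes the initial potentials exactly `s` and `s/δ_U`.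
  have hn' : (n : ℝ) = r * Real.sqrt ((n : ℝ) / r) ^ 2 := by rw [hsq]; field_simp
  set s := Real.sqrt ((n : ℝ) / r) with hsdef
  have hL : barrierL n r 0 = -(r * s) := by rw [barrierL, sqrt_mul_eq]; simp [hsdef]
  have hU : barrierU n r 0 = deltaU n r * (r * s) := by
    rw [barrierU, mul_comm (n : ℝ) r, sqrt_mul_eq]; simp [hsdef]
  refine ⟨isHermitian_zero, ?_, ?_, ?_, ?_⟩
  · rw [hL, zero_sub, neg_smul, neg_neg]
    exact PosDef.one.smul (by positivity)
  · rw [hU, sub_zero]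
    exact PosDef.one.smul (by positivity)
  · rw [← hsdef, lowerPotential, hroots, hL, Multiset.map_replicate, Multiset.sum_replicate, nsmul_eq_mul,
      hn']
    apply le_of_eq; field_simp; simp
  · rw [← hsdef, upperPotential, hroots, hU, Multiset.map_replicate, Multiset.sum_replicate, nsmul_eq_mul,
      hn']
    apply le_of_eq; field_simp; simp

/-- On a zero row both `𝒰` and `ℒ` vanish, which would force `t⁻¹ = 0`. -/
theorem IsBSSChoice.row_ne_zero {τ : ℕ} {U : Matrix (Fin d) (Fin n) ℝ}
    {A : Matrix (Fin n) (Fin n) ℝ} {i : Fin d} {t : ℝ} (hc : IsBSSChoice U r τ A i t) :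
    U i ≠ 0 := by
  intro h
  have h1 := hc.weight_inv
  have h2 := inv_pos.2 hc.weight_pos
  simp [stepUpper, stepLower, upperFun, lowerFun, h] at h1
  exact hc.weight_pos.ne' h1

theorem BarrierInvariant.lower_shift {τ : ℕ} {A : Matrix (Fin n) (Fin n) ℝ}
    (hs : Real.sqrt ((n : ℝ) / r) < 1) (h : BarrierInvariant r τ A) :
    (A - (barrierL n r τ + 1) • (1 : Matrix (Fin n) (Fin n) ℝ)).PosDef :=
  posDef_sub_add_smul_one h.isHermitian h.lower_posDef
    (by rw [div_one]; exact h.lower_le.trans_lt hs)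

/-- As the midpoint of `𝒰 ≤ ℒ`, the number `t⁻¹` meets the requirements of both barrier updates. -/
theorem BarrierInvariant.step (hn : 0 < n) (hs : Real.sqrt ((n : ℝ) / r) < 1) {τ : ℕ}
    {U : Matrix (Fin d) (Fin n) ℝ} {A : Matrix (Fin n) (Fin n) ℝ} (h : BarrierInvariant r τ A)
    {i : Fin d} {t : ℝ} (hc : IsBSSChoice U r τ A i t) :
    BarrierInvariant r (τ + 1) (A + t • vecMulVec (U i) (U i)) := by
  have h1 := hc.weight_inv
  have h2 := hc.upper_le_lower
  obtain ⟨hl, hl'⟩ := lower_barrier_update hn h.isHermitian one_pos (h.lower_shift hs)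
    hc.weight_pos (u := U i) (by unfold stepLower at *; linarith)
  obtain ⟨hu, hu'⟩ := upper_barrier_update hn h.isHermitian (deltaU_pos hs) h.upper_posDef
    hc.weight_pos hc.row_ne_zero (by unfold stepUpper at *; linarith)
  refine ⟨h.isHermitian.add (isHermitian_smul_vecMulVec_self _ _), ?_, ?_, ?_, ?_⟩
  · rwa [barrierL_succ]
  · rwa [barrierU_succ]
  · rw [barrierL_succ]; exact hl'.trans h.lower_le
  · rw [barrierU_succ]; exact hu'.trans h.upper_le

theorem BarrierInvariant.of_run (hn : 0 < n) (hr : 0 < r) (hs : Real.sqrt ((n : ℝ) / r) < 1)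
    {U : Matrix (Fin d) (Fin n) ℝ} {k : ℕ} {A : ℕ → Matrix (Fin n) (Fin n) ℝ} {i : ℕ → Fin d}
    {t : ℕ → ℝ} (h : IsBSSRun U r k A i t) : ∀ τ ≤ k, BarrierInvariant r τ (A τ) := by
  intro τ
  induction τ with
  | zero => intro _; rw [h.init]; exact .zero hn hr hs
  | succ τ ih =>
    intro hτ
    rw [h.update τ (by omega)]
    exact (ih (by omega)).step hn hs (h.choice τ (by omega))

theorem exists_row_ne_zero (hn : 0 < n) {U : Matrix (Fin d) (Fin n) ℝ} (hU : Uᵀ * U = 1) :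
    ∃ i, U i ≠ 0 := by
  by_contra! h
  have h0 : U = 0 := funext h
  have := congrFun (congrFun hU ⟨0, hn⟩) ⟨0, hn⟩
  simp [h0] at this

theorem BarrierInvariant.exists_choice (hn : 0 < n) (hs : Real.sqrt ((n : ℝ) / r) < 1) {τ : ℕ}
    {U : Matrix (Fin d) (Fin n) ℝ} (hU : Uᵀ * U = 1) {A : Matrix (Fin n) (Fin n) ℝ}
    (h : BarrierInvariant r τ A) : ∃ (j : Fin d) (s : ℝ), IsBSSChoice U r τ A j s := by
  have hδ := deltaU_pos hs
  have hs0 := Real.sqrt_nonneg ((n : ℝ) / r)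
  have hl := le_sum_lowerFun hU hn h.isHermitian one_pos h.lower_posDef
    (by rw [div_one]; exact h.lower_le.trans_lt hs)
  have hu := sum_upperFun_le hU hn h.isHermitian hδ h.upper_posDef
  -- This equality dictates `δ_U`: the upper bound `(1 + s)/δ_U` for `∑ 𝒰` meets the lower bound `1
  -- - s` for `∑ ℒ`.
  have hd : 1 / deltaU n r + Real.sqrt ((n : ℝ) / r) / deltaU n r =
      1 - Real.sqrt ((n : ℝ) / r) := by
    rw [← add_div, deltaU]
    have : 1 + Real.sqrt ((n : ℝ) / r) ≠ 0 := by positivity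
    have : 1 - Real.sqrt ((n : ℝ) / r) ≠ 0 := by linarith
    field_simp
  have hle : ∑ i, stepUpper U r τ A i ≤ ∑ i, stepLower U r τ A i := by
    have h1 := h.lower_le
    have h2 := h.upper_le
    unfold stepUpper stepLower
    linarith
  -- A zero row satisfies `𝒰 ≤ ℒ` trivially but admits no weight. Were the inequality to fail on all
  -- nonzero rows, the sums would compare strictly the other way.
  have hex : ∃ j, U j ≠ 0 ∧ stepUpper U r τ A j ≤ stepLower U r τ A j := by
    by_contra! hcon
    obtain ⟨j, hj⟩ := exists_row_ne_zero hn hU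
    refine absurd hle (not_le.2 (Finset.sum_lt_sum (fun i _ => ?_) ⟨j, Finset.mem_univ j, hcon j hj⟩))
    by_cases hi : U i = 0
    · simp [stepUpper, stepLower, upperFun, lowerFun, hi]
    · exact (hcon i hi).le
  obtain ⟨j, hj, hjle⟩ := hex
  have hpos : 0 < stepUpper U r τ A j := upperFun_pos hn h.isHermitian hδ h.upper_posDef hj
  refine ⟨j, ((1 / 2) * (stepUpper U r τ A j + stepLower U r τ A j))⁻¹, ?_, hjle, inv_inv _⟩
  exact inv_pos.2 (by linarith)

theorem IsBSSRun.eq_sum {U : Matrix (Fin d) (Fin n) ℝ} {k : ℕ}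
    {A : ℕ → Matrix (Fin n) (Fin n) ℝ} {i : ℕ → Fin d} {t : ℕ → ℝ} (h : IsBSSRun U r k A i t) :
    ∀ τ ≤ k, A τ = ∑ j ∈ Finset.range τ, t j • vecMulVec (U (i j)) (U (i j)) := by
  intro τ
  induction τ with
  | zero => intro _; simp [h.init]
  | succ τ ih =>
    intro hτ
    rw [h.update τ (by omega), ih (by omega), Finset.sum_range_succ]

theorem gram_bssMatrix_mul {U : Matrix (Fin d) (Fin n) ℝ} {A : ℕ → Matrix (Fin n) (Fin n) ℝ}
    {i : ℕ → Fin d} {t : ℕ → ℝ} (hs : Real.sqrt ((n : ℝ) / r) < 1) (h : IsBSSRun U r r A i t) :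
    (bssMatrix n r i t * U)ᵀ * (bssMatrix n r i t * U) =
      ((r : ℝ)⁻¹ * (1 - Real.sqrt ((n : ℝ) / r))) • A r := by
  set c := (r : ℝ)⁻¹ * (1 - Real.sqrt ((n : ℝ) / r))
  have hc : 0 ≤ c := mul_nonneg (by positivity) (by linarith)
  have hrow : ∀ (τ : Fin r) (b : Fin n),
      (bssMatrix n r i t * U) τ b = Real.sqrt (t τ) * Real.sqrt c * U (i τ) b := by
    intro τ b
    rw [bssMatrix, Matrix.mul_assoc, rescalingMatrix, diagonal_mul]
    simp [samplingMatrix, Matrix.mul_apply, c]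
  rw [h.eq_sum r le_rfl]
  ext a b
  rw [Matrix.mul_apply, Matrix.smul_apply, Matrix.sum_apply, Finset.sum_range, smul_eq_mul,
    Finset.mul_sum]
  refine Finset.sum_congr rfl fun τ _ => ?_
  rw [transpose_apply, hrow, hrow, Matrix.smul_apply, vecMulVec_apply, smul_eq_mul]
  have h1 := Real.mul_self_sqrt (h.choice τ τ.2).weight_pos.le
  have h2 := Real.mul_self_sqrt hc
  calc _ = (Real.sqrt (t τ) * Real.sqrt (t τ)) * (Real.sqrt c * Real.sqrt c) *
        (U (i τ) a * U (i τ) b) := by ring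
    _ = _ := by rw [h1, h2]; ring

/-- The sampled Gram matrix `(RU)ᵀ(RU)` is positive definite and close to the identity as a
quadratic form. -/
theorem gram_bssMatrix_bounds (hn : 0 < n) (hr : 0 < r) (hs : Real.sqrt ((n : ℝ) / r) < 1)
    {U : Matrix (Fin d) (Fin n) ℝ} {A : ℕ → Matrix (Fin n) (Fin n) ℝ}
    {i : ℕ → Fin d} {t : ℕ → ℝ} (h : IsBSSRun U r r A i t) (x : Fin n → ℝ) :
    (1 - Real.sqrt ((n : ℝ) / r)) ^ 2 * (x ⬝ᵥ x) ≤
      x ⬝ᵥ (((bssMatrix n r i t * U)ᵀ * (bssMatrix n r i t * U)) *ᵥ x) ∧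
    x ⬝ᵥ (((bssMatrix n r i t * U)ᵀ * (bssMatrix n r i t * U)) *ᵥ x) ≤
      (1 + Real.sqrt ((n : ℝ) / r)) ^ 2 * (x ⬝ᵥ x) := by
  have hinv := BarrierInvariant.of_run hn hr hs h r le_rfl
  have hl := hinv.lower_posDef.posSemidef.dotProduct_mulVec_nonneg x
  have hu := hinv.upper_posDef.posSemidef.dotProduct_mulVec_nonneg x
  have hr' : (0 : ℝ) < r := by exact_mod_cast hr
  rw [gram_bssMatrix_mul hs h, smul_mulVec, dotProduct_smul, smul_eq_mul]
  simp only [star_trivial, sub_mulVec, smul_mulVec, one_mulVec, dotProduct_sub, dotProduct_smul,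
    smul_eq_mul, barrierL, barrierU, deltaU, mul_comm (n : ℝ) r, sqrt_mul_eq] at hl hu
  set s := Real.sqrt ((n : ℝ) / r)
  have h1s : 0 < 1 - s := by linarith
  have hc : 0 < (r : ℝ)⁻¹ * (1 - s) := by positivity
  -- The final barriers are `r(1 - s)` and `δ_U r(1 + s)`; the scaling `r⁻¹(1 - s)` turns them into
  -- `(1 - s)²` and `(1 + s)²`.
  constructor
  · calc _ = (r : ℝ)⁻¹ * (1 - s) * ((r - r * s) * (x ⬝ᵥ x)) := by field_simp
      _ ≤ _ := mul_le_mul_of_nonneg_left (by linarith) hc.le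
  · calc _ ≤ (r : ℝ)⁻¹ * (1 - s) * ((1 + s) / (1 - s) * (r + r * s) * (x ⬝ᵥ x)) :=
          mul_le_mul_of_nonneg_left (by linarith) hc.le
      _ = _ := by field_simp

end Run

/-! ### Euclidean norm -/

section Norm

variable {n : ℕ}

theorem l2norm_nonneg (v : Fin n → ℝ) : 0 ≤ l2norm v := norm_nonneg _

theorem l2norm_sq (v : Fin n → ℝ) : l2norm v ^ 2 = v ⬝ᵥ v := by
  rw [l2norm, EuclideanSpace.real_norm_sq_eq]
  simp [dotProduct, pow_two]

theorem abs_dotProduct_le (v w : Fin n → ℝ) : |v ⬝ᵥ w| ≤ l2norm v * l2norm w := by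
  refine abs_le_of_sq_le_sq ?_ (mul_nonneg (l2norm_nonneg v) (l2norm_nonneg w))
  rw [mul_pow, l2norm_sq, l2norm_sq]
  simpa [dotProduct, pow_two] using Finset.sum_mul_sq_le_sq_mul_sq Finset.univ v w

theorem l2norm_smul (c : ℝ) (v : Fin n → ℝ) : l2norm (c • v) = |c| * l2norm v := by
  rw [l2norm, l2norm, WithLp.toLp_smul, norm_smul, Real.norm_eq_abs]

theorem l2norm_le_of_abs_le {v w : Fin n → ℝ} {c : ℝ} (hc : 0 ≤ c)
    (h : ∀ i, |v i| ≤ c * |w i|) : l2norm v ≤ c * l2norm w := by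
  refine le_of_sq_le_sq ?_ (mul_nonneg hc (l2norm_nonneg w))
  rw [mul_pow, l2norm_sq, l2norm_sq, dotProduct, dotProduct, Finset.mul_sum]
  refine Finset.sum_le_sum fun i _ => ?_
  have := mul_self_le_mul_self (abs_nonneg _) (h i)
  rw [abs_mul_abs_self] at this
  calc _ ≤ _ := this
    _ = c ^ 2 * (|w i| * |w i|) := by ring
    _ = _ := by rw [abs_mul_abs_self]

/-- A symmetric matrix whose quadratic form is bounded by `ε` has bilinear form bounded by `ε`. -/
theorem abs_dotProduct_mulVec_le {E : Matrix (Fin n) (Fin n) ℝ} (hE : E.IsHermitian) {ε : ℝ}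
    (h : ∀ x, |x ⬝ᵥ (E *ᵥ x)| ≤ ε * (x ⬝ᵥ x)) (x y : Fin n → ℝ) :
    |x ⬝ᵥ (E *ᵥ y)| ≤ ε * l2norm x * l2norm y := by
  have hpol : ∀ x y : Fin n → ℝ, |x ⬝ᵥ (E *ᵥ y)| ≤ ε / 2 * (x ⬝ᵥ x + y ⬝ᵥ y) := by
    intro x y
    have h1 := abs_le.1 (h (x + y))
    have h2 := abs_le.1 (h (x - y))
    simp only [mulVec_add, mulVec_sub, add_dotProduct, sub_dotProduct, dotProduct_add,
      dotProduct_sub, dotProduct_mulVec_comm_of_isHermitian hE y x, dotProduct_comm y x] at h1 h2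
    rw [abs_le]
    constructor <;> linarith [h1.1, h1.2, h2.1, h2.2]
  rcases (l2norm_nonneg x).eq_or_lt with hx | hx
  · have : x = 0 := dotProduct_self_eq_zero.1 (by rw [← l2norm_sq, ← hx]; simp)
    rw [← hx, this]
    simp
  rcases (l2norm_nonneg y).eq_or_lt with hy | hy
  · have : y = 0 := dotProduct_self_eq_zero.1 (by rw [← l2norm_sq, ← hy]; simp)
    rw [← hy, this]
    simp
  -- Rescaling both vectors to the common norm `‖x‖‖y‖` turns the arithmetic mean in `hpol` into the
  -- product of the norms.
  have h3 := hpol (l2norm y • x) (l2norm x • y)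
  simp only [mulVec_smul, smul_dotProduct, dotProduct_smul, smul_eq_mul, abs_mul,
    ← l2norm_sq, abs_of_pos hx, abs_of_pos hy] at h3
  have h4 : 0 < l2norm x * l2norm y := mul_pos hx hy
  refine le_of_mul_le_mul_left ?_ h4
  calc _ = _ := by ring
    _ ≤ _ := h3
    _ = _ := by ring

end Norm

/-! ### Regularized least squares -/

section Regression

variable {d n : ℕ}

/-- At such an `x` the residual is `-λx`, so the terms linear in `z - x` cancel. The remainder is
positive for `z ≠ x` once `XᵀX` is positive definite, which yields both optimality and uniqueness.
-/
theorem rlscObjective_eq_add {X : Matrix (Fin d) (Fin n) ℝ} {y x : Fin n → ℝ} {lam : ℝ}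
    (hx : (Xᵀ * X) *ᵥ x + lam • x = y) (z : Fin n → ℝ) :
    rlscObjective lam X y z = rlscObjective lam X y x + l2norm ((Xᵀ * X) *ᵥ (z - x)) ^ 2 +
      lam * ((z - x) ⬝ᵥ ((Xᵀ * X) *ᵥ (z - x))) := by
  have hK : (Xᵀ * X).IsHermitian := by
    simpa using isHermitian_conjTranspose_mul_self X
  obtain ⟨h, rfl⟩ : ∃ h, z = x + h := ⟨z - x, by abel⟩
  simp only [rlscObjective, l2norm_sq, add_sub_cancel_left]
  have h1 := dotProduct_mulVec_comm_of_isHermitian hK h x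
  rw [← hx, mulVec_add]
  set p := (Xᵀ * X) *ᵥ x
  set k := (Xᵀ * X) *ᵥ h
  have h2 := dotProduct_comm k x
  rw [show p + k - (p + lam • x) = k - lam • x by abel, show p - (p + lam • x) = -(lam • x) by abel]
  simp only [add_dotProduct, sub_dotProduct, dotProduct_add, dotProduct_sub, neg_dotProduct,
    dotProduct_neg, smul_dotProduct, dotProduct_smul, smul_eq_mul]
  linear_combination lam * h1 - 2 * lam * h2 + lam * h2

theorem isRLSCSolution_iff {X : Matrix (Fin d) (Fin n) ℝ} (hX : (Xᵀ * X).PosDef) {lam : ℝ}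
    (hlam : 0 < lam) (y x : Fin n → ℝ) :
    IsRLSCSolution lam X y x ↔ (Xᵀ * X) *ᵥ x + lam • x = y := by
  have hex : ∃ x₀, (Xᵀ * X) *ᵥ x₀ + lam • x₀ = y := by
    have hP : (Xᵀ * X + lam • (1 : Matrix (Fin n) (Fin n) ℝ)).PosDef :=
      hX.add (PosDef.one.smul hlam)
    refine ⟨(Xᵀ * X + lam • (1 : Matrix (Fin n) (Fin n) ℝ))⁻¹ *ᵥ y, ?_⟩
    have : (Xᵀ * X + lam • (1 : Matrix (Fin n) (Fin n) ℝ)) *ᵥ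
        ((Xᵀ * X + lam • (1 : Matrix (Fin n) (Fin n) ℝ))⁻¹ *ᵥ y) = y := by
      rw [mulVec_mulVec, mul_nonsing_inv _ ((isUnit_iff_isUnit_det _).1 hP.isUnit), one_mulVec]
    simpa only [add_mulVec, smul_mulVec, one_mulVec] using this
  constructor
  · intro h
    obtain ⟨x₀, hx₀⟩ := hex
    by_cases hne : x - x₀ = 0
    · rwa [sub_eq_zero.1 hne]
    · have h1 := h x₀
      rw [rlscObjective_eq_add hx₀ x] at h1
      have h2 := hX.dotProduct_mulVec_pos hne
      simp only [star_trivial] at h2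
      have h3 := mul_pos hlam h2
      have h4 := sq_nonneg (l2norm ((Xᵀ * X) *ᵥ (x - x₀)))
      linarith
  · intro h z
    have h2 := hX.posSemidef.dotProduct_mulVec_nonneg (z - x)
    simp only [star_trivial] at h2
    have h3 := mul_nonneg hlam.le h2
    have h4 := sq_nonneg (l2norm ((Xᵀ * X) *ᵥ (z - x)))
    rw [rlscObjective_eq_add h z]
    linarith

theorem existsUnique_isRLSCSolution {X : Matrix (Fin d) (Fin n) ℝ} (hX : (Xᵀ * X).PosDef)
    {lam : ℝ} (hlam : 0 < lam) (y : Fin n → ℝ) : ∃! x, IsRLSCSolution lam X y x := by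
  have hP : (Xᵀ * X + lam • (1 : Matrix (Fin n) (Fin n) ℝ)).PosDef :=
    hX.add (PosDef.one.smul hlam)
  have hdet := (isUnit_iff_isUnit_det _).1 hP.isUnit
  have heq : ∀ x, IsRLSCSolution lam X y x ↔
      (Xᵀ * X + lam • (1 : Matrix (Fin n) (Fin n) ℝ)) *ᵥ x = y := fun x => by
    rw [isRLSCSolution_iff hX hlam, add_mulVec, smul_mulVec, one_mulVec]
  refine ⟨(Xᵀ * X + lam • (1 : Matrix (Fin n) (Fin n) ℝ))⁻¹ *ᵥ y, ?_, fun x hx => ?_⟩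
  · show IsRLSCSolution lam X y _
    rw [heq, mulVec_mulVec, mul_nonsing_inv _ hdet, one_mulVec]
  · rw [← (heq x).1 hx, mulVec_mulVec, nonsing_inv_mul _ hdet, one_mulVec]

theorem prediction_mulVec (X : Matrix (Fin d) (Fin n) ℝ) (x α : Fin n → ℝ) :
    prediction X x (X *ᵥ α) = α ⬝ᵥ ((Xᵀ * X) *ᵥ x) := by
  rw [prediction, ← mulVec_mulVec, dotProduct_mulVec α, vecMul_transpose]

end Regression

/-! ### Perturbation in singular coordinates -/

section Perturbation

variable {n : ℕ} {σ a b ξ ξ' w : Fin n → ℝ} {lam : ℝ} {M : Matrix (Fin n) (Fin n) ℝ}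

/-- Since `bᵢ = (σᵢ² + λ)ξᵢ`, the filter factor in `w` cancels. This identifies `w ⬝ b` with the
full prediction. -/
theorem dotProduct_filtered_eq (hlam : 0 < lam)
    (hw : ∀ i, w i = σ i ^ 2 / (σ i ^ 2 + lam) * a i)
    (hξ : ∀ i, σ i * (σ i * ξ i) + lam * ξ i = b i) :
    w ⬝ᵥ b = ∑ i, a i * (σ i * (σ i * ξ i)) := by
  refine Finset.sum_congr rfl fun i _ => ?_
  have : σ i ^ 2 + lam ≠ 0 := by positivity
  rw [hw, ← hξ]
  field_simp

theorem perturbation_eq (hlam : 0 < lam) (hσ : ∀ i, 0 < σ i)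
    (hw : ∀ i, w i = σ i ^ 2 / (σ i ^ 2 + lam) * a i)
    (hξ : ∀ i, σ i * (σ i * ξ i) + lam * ξ i = b i)
    (hξ' : ∀ i, σ i * (M *ᵥ fun j => σ j * ξ' j) i + lam * ξ' i = b i) :
    ∑ i, a i * (σ i * (M *ᵥ fun j => σ j * ξ' j) i) - ∑ i, a i * (σ i * (σ i * ξ i)) =
      (fun i => w i / σ i) ⬝ᵥ ((M - 1) *ᵥ (lam • fun j => σ j * ξ' j)) := by
  rw [← Finset.sum_sub_distrib, mulVec_smul, sub_mulVec, one_mulVec]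
  refine Finset.sum_congr rfl fun i _ => ?_
  have h1 := hσ i
  have h2 : σ i ^ 2 + lam ≠ 0 := by positivity
  have h3 := hξ i
  have h4 := hξ' i
  simp only [Pi.smul_apply, Pi.sub_apply, smul_eq_mul]
  rw [hw]
  set m := (M *ᵥ fun j => σ j * ξ' j) i
  -- The difference of the two normal equations, times `σᵢ`; `m - σᵢξ'ᵢ` is the `i`-th entry of `(M
  -- - 1)Σξ'`.
  have h5 : (σ i ^ 2 + lam) * (m - σ i * ξ i) = lam * (m - σ i * ξ' i) := by
    linear_combination σ i * h4 - σ i * h3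
  field_simp
  linear_combination a i * h5

/-- Pairing the equation with `ξ'` and dropping the nonnegative form of `M` leaves `λ‖ξ'‖² ≤ ξ' ⬝ b
≤ ‖ξ'‖‖b‖`. -/
theorem l2norm_regularized_le (hM : ∀ x, 0 ≤ x ⬝ᵥ (M *ᵥ x))
    (hξ' : ∀ i, σ i * (M *ᵥ fun j => σ j * ξ' j) i + lam * ξ' i = b i) :
    lam * l2norm ξ' ≤ l2norm b := by
  have h1 : ξ' ⬝ᵥ b = (fun j => σ j * ξ' j) ⬝ᵥ (M *ᵥ fun j => σ j * ξ' j) + lam * (ξ' ⬝ᵥ ξ') := by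
    simp only [dotProduct, Finset.mul_sum, ← Finset.sum_add_distrib]
    refine Finset.sum_congr rfl fun i _ => ?_
    rw [← hξ' i]; ring
  have h2 := hM fun j => σ j * ξ' j
  have h3 := (le_abs_self _).trans (abs_dotProduct_le ξ' b)
  rcases (l2norm_nonneg ξ').eq_or_lt with h0 | h0
  · rw [← h0, mul_zero]; exact l2norm_nonneg b
  · refine le_of_mul_le_mul_left ?_ h0
    rw [← l2norm_sq] at h1
    nlinarith

/-- The condition number arises from `Σ⁻¹` acting on `w` and `Σ` acting on `λξ'`; the factor `λ` is
absorbed by `l2norm_regularized_le`. -/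
theorem abs_perturbation_le (hn : 0 < n) (hlam : 0 < lam) (hσ : ∀ i, 0 < σ i) {ε : ℝ}
    (hε : 0 ≤ ε) (hMh : M.IsHermitian) (hM : ∀ x, 0 ≤ x ⬝ᵥ (M *ᵥ x))
    (hMε : ∀ x, |x ⬝ᵥ ((M - 1) *ᵥ x)| ≤ ε * (x ⬝ᵥ x))
    (hw : ∀ i, w i = σ i ^ 2 / (σ i ^ 2 + lam) * a i)
    (hξ : ∀ i, σ i * (σ i * ξ i) + lam * ξ i = b i)
    (hξ' : ∀ i, σ i * (M *ᵥ fun j => σ j * ξ' j) i + lam * ξ' i = b i) :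
    |∑ i, a i * (σ i * (M *ᵥ fun j => σ j * ξ' j) i) - ∑ i, a i * (σ i * (σ i * ξ i))| ≤
      ε * condNumber σ * (l2norm w * l2norm b) := by
  have : Nonempty (Fin n) := ⟨⟨0, hn⟩⟩
  obtain ⟨i₀, hi₀⟩ := exists_eq_ciInf_of_finite (f := σ)
  have hinf : 0 < ⨅ i, σ i := hi₀ ▸ hσ i₀
  have hle : ∀ i, ⨅ i, σ i ≤ σ i := ciInf_le (Set.finite_range σ).bddBelow
  have hge : ∀ i, σ i ≤ ⨆ i, σ i := le_ciSup (Set.finite_range σ).bddAbove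
  have hsup : 0 < ⨆ i, σ i := (hσ i₀).trans_le (hge i₀)
  rw [perturbation_eq hlam hσ hw hξ hξ']
  refine (abs_dotProduct_mulVec_le (hMh.sub isHermitian_one) hMε _ _).trans ?_
  have h1 : l2norm (fun i => w i / σ i) ≤ (⨅ i, σ i)⁻¹ * l2norm w :=
    l2norm_le_of_abs_le (inv_nonneg.2 hinf.le) fun i => by
      rw [abs_div, abs_of_pos (hσ i), div_eq_inv_mul]
      exact mul_le_mul_of_nonneg_right (inv_anti₀ hinf (hle i)) (abs_nonneg _)
  have h2 : l2norm (lam • fun j => σ j * ξ' j) ≤ (⨆ i, σ i) * l2norm b := by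
    have h3 : l2norm (fun j => σ j * ξ' j) ≤ (⨆ i, σ i) * l2norm ξ' :=
      l2norm_le_of_abs_le hsup.le fun i => by
        rw [abs_mul, abs_of_pos (hσ i)]
        exact mul_le_mul_of_nonneg_right (hge i) (abs_nonneg _)
    rw [l2norm_smul, abs_of_pos hlam]
    calc _ ≤ lam * ((⨆ i, σ i) * l2norm ξ') := mul_le_mul_of_nonneg_left h3 hlam.le
      _ = (⨆ i, σ i) * (lam * l2norm ξ') := by ring
      _ ≤ _ := mul_le_mul_of_nonneg_left (l2norm_regularized_le hM hξ') hsup.le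
  calc _ ≤ ε * ((⨅ i, σ i)⁻¹ * l2norm w) * ((⨆ i, σ i) * l2norm b) :=
        mul_le_mul (mul_le_mul_of_nonneg_left h1 hε) h2 (l2norm_nonneg _)
          (mul_nonneg hε (mul_nonneg (inv_nonneg.2 hinf.le) (l2norm_nonneg _)))
    _ = _ := by rw [condNumber]; ring

end Perturbation

/-! ### Gram matrices in singular coordinates -/

section SVD

variable {d n : ℕ} {X U : Matrix (Fin d) (Fin n) ℝ} {σ : Fin n → ℝ}
  {V : Matrix (Fin n) (Fin n) ℝ}

/-- `X` factors through `diagonal σ`, whose rank counts the nonzero entries, so a vanishing `σ i`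
would push the rank of `X` below `n`. -/
theorem IsThinSVD.pos (h : IsThinSVD X U σ V) (hX : X.rank = n) (i : Fin n) : 0 < σ i := by
  refine lt_of_le_of_ne (h.nonneg i) fun h0 => ?_
  have h1 : X.rank ≤ (diagonal σ).rank := by
    rw [h.factor]
    exact (rank_mul_le_left _ _).trans (rank_mul_le_right _ _)
  rw [hX, rank_diagonal] at h1
  have h2 : Fintype.card {j // σ j ≠ 0} < Fintype.card (Fin n) :=
    Fintype.card_subtype_lt (x := i) (by simp [← h0])
  rw [Fintype.card_fin] at h2
  omega

theorem gram_mul_svd {m : ℕ} (Y : Matrix (Fin m) (Fin n) ℝ) (σ : Fin n → ℝ)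
    (V : Matrix (Fin n) (Fin n) ℝ) :
    (Y * diagonal σ * Vᵀ)ᵀ * (Y * diagonal σ * Vᵀ) =
      (diagonal σ * Vᵀ)ᵀ * (Yᵀ * Y) * (diagonal σ * Vᵀ) := by
  simp only [transpose_mul, transpose_transpose, Matrix.mul_assoc]

theorem posDef_conj_svd (hV : Vᵀ * V = 1) (hσ : ∀ i, 0 < σ i) {M : Matrix (Fin n) (Fin n) ℝ}
    (hM : M.PosDef) : ((diagonal σ * Vᵀ)ᵀ * M * (diagonal σ * Vᵀ)).PosDef := by
  have hu : IsUnit (diagonal σ * Vᵀ) := by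
    refine IsUnit.mul ?_ (IsUnit.of_mul_eq_one _ hV)
    rw [isUnit_iff_isUnit_det, det_diagonal, isUnit_iff_ne_zero]
    exact Finset.prod_ne_zero_iff.2 fun i _ => (hσ i).ne'
  have := hu.posDef_star_left_conjugate_iff (x := M)
  rw [star_eq_conjTranspose, conjTranspose_eq_transpose_of_trivial] at this
  exact this.2 hM

theorem transpose_mulVec_conj_svd (hV : Vᵀ * V = 1) (M : Matrix (Fin n) (Fin n) ℝ)
    (x : Fin n → ℝ) (i : Fin n) :
    (Vᵀ *ᵥ (((diagonal σ * Vᵀ)ᵀ * M * (diagonal σ * Vᵀ)) *ᵥ x)) i =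
      σ i * (M *ᵥ fun j => σ j * (Vᵀ *ᵥ x) j) i := by
  have h1 : Vᵀ * ((diagonal σ * Vᵀ)ᵀ * M * (diagonal σ * Vᵀ)) =
      diagonal σ * (M * (diagonal σ * Vᵀ)) := by
    rw [transpose_mul, transpose_transpose, diagonal_transpose]
    calc _ = (Vᵀ * V) * (diagonal σ * (M * (diagonal σ * Vᵀ))) := by
          simp only [Matrix.mul_assoc]
      _ = _ := by rw [hV, Matrix.one_mul]
  have h2 : (diagonal σ *ᵥ (Vᵀ *ᵥ x)) = fun j => σ j * (Vᵀ *ᵥ x) j :=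
    funext fun j => mulVec_diagonal _ _ _
  rw [mulVec_mulVec, h1, ← mulVec_mulVec, mulVec_diagonal, ← mulVec_mulVec, ← mulVec_mulVec, h2]

theorem dotProduct_eq_of_orthogonal (hV : Vᵀ * V = 1) (x y : Fin n → ℝ) :
    x ⬝ᵥ y = (Vᵀ *ᵥ x) ⬝ᵥ (Vᵀ *ᵥ y) := by
  have h : V * Vᵀ = 1 := mul_eq_one_comm.1 hV
  rw [dotProduct_mulVec (Vᵀ *ᵥ x), vecMul_transpose, mulVec_mulVec, h, one_mulVec]

theorem filter_apply {lam : ℝ} (hlam : 0 < lam) (hσ : ∀ i, 0 < σ i) (a : Fin n → ℝ)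
    (i : Fin n) :
    (((1 + lam • (diagonal σ ^ 2)⁻¹)⁻¹ : Matrix (Fin n) (Fin n) ℝ) *ᵥ a) i =
      σ i ^ 2 / (σ i ^ 2 + lam) * a i := by
  have h1 : (diagonal σ ^ 2)⁻¹ = diagonal fun i => (σ i ^ 2)⁻¹ := by
    apply inv_eq_right_inv
    rw [diagonal_pow, diagonal_mul_diagonal, ← diagonal_one]
    congr 1; ext i
    exact mul_inv_cancel₀ (pow_pos (hσ i) 2).ne'
  have h2 : (1 + lam • (diagonal σ ^ 2)⁻¹)⁻¹ =
      diagonal fun i => σ i ^ 2 / (σ i ^ 2 + lam) := by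
    apply inv_eq_right_inv
    rw [h1, ← diagonal_smul, ← diagonal_one, diagonal_add, diagonal_mul_diagonal]
    congr 1; ext i
    have := hσ i
    simp only [Pi.smul_apply, smul_eq_mul]
    field_simp
  rw [h2, mulVec_diagonal]

end SVD

/-- `(RU)ᵀ(RU)` differs from the identity by at most `ε` as a quadratic form. -/
theorem abs_gram_sub_one_le {n : ℕ} {s ε : ℝ} {M : Matrix (Fin n) (Fin n) ℝ}
    (hs : 2 * s + s ^ 2 ≤ ε) {x : Fin n → ℝ} (hl : (1 - s) ^ 2 * (x ⬝ᵥ x) ≤ x ⬝ᵥ (M *ᵥ x))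
    (hu : x ⬝ᵥ (M *ᵥ x) ≤ (1 + s) ^ 2 * (x ⬝ᵥ x)) :
    |x ⬝ᵥ ((M - 1) *ᵥ x)| ≤ ε * (x ⬝ᵥ x) := by
  have h0 : 0 ≤ x ⬝ᵥ x := by rw [← l2norm_sq]; positivity
  rw [sub_mulVec, one_mulVec, dotProduct_sub, abs_le]
  constructor <;> nlinarith [mul_le_mul_of_nonneg_right hs h0, mul_nonneg (sq_nonneg s) h0]

theorem sampling_parameter_bounds {n r : ℕ} (hn : 0 < n) {ε : ℝ} (hε0 : 0 < ε)
    (hr : 9 * (n : ℝ) / ε ^ 2 ≤ (r : ℝ)) :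
    0 < r ∧ Real.sqrt ((n : ℝ) / r) ≤ ε / 3 := by
  have hn' : (0 : ℝ) < n := by exact_mod_cast hn
  have hr0 : (0 : ℝ) < r := lt_of_lt_of_le (by positivity) hr
  refine ⟨by exact_mod_cast hr0, Real.sqrt_le_iff.2 ⟨by positivity, ?_⟩⟩
  rw [div_le_iff₀ (by positivity)] at hr
  rw [div_le_iff₀ hr0]
  linarith

end RLSC

open Matrix in
theorem theorem2 {d n r : ℕ} (hn : 0 < n)
    (X : Matrix (Fin d) (Fin n) ℝ) (hX : X.rank = n)
    (U : Matrix (Fin d) (Fin n) ℝ) (σ : Fin n → ℝ) (V : Matrix (Fin n) (Fin n) ℝ)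
    (hSVD : RLSC.IsThinSVD X U σ V)
    (y : Fin n → ℝ) (lam : ℝ) (hlam : 0 < lam)
    (ε : ℝ) (hε0 : 0 < ε) (hε : ε ≤ 1 / 2) (hr : 9 * (n : ℝ) / ε ^ 2 ≤ (r : ℝ))
    (α : Fin n → ℝ) (q : Fin d → ℝ) (hq : q = X.mulVec α)
    (w : Fin n → ℝ)
    (hw : w = ((1 + lam • (Matrix.diagonal σ ^ 2)⁻¹)⁻¹ : Matrix (Fin n) (Fin n) ℝ).mulVec
      (V.transpose.mulVec α))
    (ω : ℝ)
    (hω : RLSC.l2norm w * RLSC.l2norm (V.transpose.mulVec y)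
      ≤ ω * |w ⬝ᵥ V.transpose.mulVec y|) :
    -- the full problem has exactly one optimal solution
    (∃! x : Fin n → ℝ, RLSC.IsRLSCSolution lam X y x) ∧
    -- the algorithm never gets stuck: after `k < r` iterations there is a next choice
    (∀ k < r, ∀ (A : ℕ → Matrix (Fin n) (Fin n) ℝ) (i : ℕ → Fin d) (t : ℕ → ℝ),
      RLSC.IsBSSRun U r k A i t → ∃ (j : Fin d) (s : ℝ), RLSC.IsBSSChoice U r k (A k) j s) ∧
    -- guarantees for every complete run
    (∀ (A : ℕ → Matrix (Fin n) (Fin n) ℝ) (i : ℕ → Fin d) (t : ℕ → ℝ),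
      RLSC.IsBSSRun U r r A i t →
      (∃! x : Fin n → ℝ, RLSC.IsRLSCSolution lam (RLSC.bssMatrix n r i t * X) y x) ∧
      ∀ xopt xopt' : Fin n → ℝ,
        RLSC.IsRLSCSolution lam X y xopt →
        RLSC.IsRLSCSolution lam (RLSC.bssMatrix n r i t * X) y xopt' →
        |w ⬝ᵥ V.transpose.mulVec y| = |RLSC.prediction X xopt q| ∧
        |RLSC.prediction (RLSC.bssMatrix n r i t * X) xopt'
              ((RLSC.bssMatrix n r i t).mulVec q)
            - RLSC.prediction X xopt q|
          ≤ 2 * ε * ω * RLSC.condNumber σ * |RLSC.prediction X xopt q|) := by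
  have hσ := hSVD.pos hX
  have hV := hSVD.right_orthonormal
  have hU := hSVD.left_orthonormal
  obtain ⟨hr0, hsε⟩ := RLSC.sampling_parameter_bounds hn hε0 hr
  have hs0 : 0 ≤ Real.sqrt ((n : ℝ) / r) := Real.sqrt_nonneg _
  have hs1 : Real.sqrt ((n : ℝ) / r) < 1 := by linarith
  have hgram : Xᵀ * X = (diagonal σ * Vᵀ)ᵀ * 1 * (diagonal σ * Vᵀ) := by
    rw [hSVD.factor, RLSC.gram_mul_svd, hU]
  have hK : (Xᵀ * X).PosDef := by
    rw [hgram]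
    exact RLSC.posDef_conj_svd hV hσ PosDef.one
  refine ⟨RLSC.existsUnique_isRLSCSolution hK hlam y, fun k hk A i t hrun => ?_,
    fun A i t hrun => ?_⟩
  · exact (RLSC.BarrierInvariant.of_run hn hr0 hs1 hrun k le_rfl).exists_choice hn hs1 hU
  set R := RLSC.bssMatrix n r i t
  have hM := RLSC.gram_bssMatrix_bounds hn hr0 hs1 hrun
  have hMh : ((R * U)ᵀ * (R * U)).IsHermitian := by
    simpa using isHermitian_conjTranspose_mul_self (R * U)
  have hgram' : (R * X)ᵀ * (R * X) =
      (diagonal σ * Vᵀ)ᵀ * ((R * U)ᵀ * (R * U)) * (diagonal σ * Vᵀ) := by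
    rw [← RLSC.gram_mul_svd, hSVD.factor]
    simp only [Matrix.mul_assoc]
  change ∀ x, _ ≤ x ⬝ᵥ (((R * U)ᵀ * (R * U)) *ᵥ x) ∧ x ⬝ᵥ (((R * U)ᵀ * (R * U)) *ᵥ x) ≤ _ at hM
  set M := (R * U)ᵀ * (R * U)
  have hM0 : ∀ x, 0 ≤ x ⬝ᵥ (M *ᵥ x) := fun x =>
    le_trans (by rw [← RLSC.l2norm_sq]; positivity) (hM x).1
  have hMpos : M.PosDef := by
    refine PosDef.of_dotProduct_mulVec_pos hMh fun x hx => ?_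
    have h1 : 0 < x ⬝ᵥ x := lt_of_le_of_ne (by rw [← RLSC.l2norm_sq]; positivity)
      fun h => hx (dotProduct_self_eq_zero.1 h.symm)
    have h2 : 0 < 1 - Real.sqrt ((n : ℝ) / r) := by linarith
    exact lt_of_lt_of_le (by positivity) (hM x).1
  have hK' : ((R * X)ᵀ * (R * X)).PosDef := by
    rw [hgram']
    exact RLSC.posDef_conj_svd hV hσ hMpos
  refine ⟨RLSC.existsUnique_isRLSCSolution hK' hlam y, fun x x' hx hx' => ?_⟩
  rw [RLSC.isRLSCSolution_iff hK hlam] at hx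
  rw [RLSC.isRLSCSolution_iff hK' hlam] at hx'
  have hw' : ∀ i, w i = σ i ^ 2 / (σ i ^ 2 + lam) * (Vᵀ *ᵥ α) i := fun i => by
    rw [hw]; exact RLSC.filter_apply hlam hσ _ i
  have hξ : ∀ i, σ i * (σ i * (Vᵀ *ᵥ x) i) + lam * (Vᵀ *ᵥ x) i = (Vᵀ *ᵥ y) i := fun i => by
    rw [← hx, mulVec_add, mulVec_smul, hgram, Pi.add_apply,
      RLSC.transpose_mulVec_conj_svd hV, one_mulVec]
    rfl
  have hξ' : ∀ i, σ i * (M *ᵥ fun j => σ j * (Vᵀ *ᵥ x') j) i + lam * (Vᵀ *ᵥ x') i =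
      (Vᵀ *ᵥ y) i := fun i => by
    rw [← hx', mulVec_add, mulVec_smul, hgram', Pi.add_apply,
      RLSC.transpose_mulVec_conj_svd hV]
    rfl
  have hpred : RLSC.prediction X x q =
      ∑ i, (Vᵀ *ᵥ α) i * (σ i * (σ i * (Vᵀ *ᵥ x) i)) := by
    rw [hq, RLSC.prediction_mulVec, RLSC.dotProduct_eq_of_orthogonal hV, dotProduct]
    refine Finset.sum_congr rfl fun i _ => ?_
    rw [hgram, RLSC.transpose_mulVec_conj_svd hV, one_mulVec]
  have hpred' : RLSC.prediction (R * X) x' (R *ᵥ q) =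
      ∑ i, (Vᵀ *ᵥ α) i * (σ i * (M *ᵥ fun j => σ j * (Vᵀ *ᵥ x') j) i) := by
    rw [hq, mulVec_mulVec, RLSC.prediction_mulVec, RLSC.dotProduct_eq_of_orthogonal hV, dotProduct]
    refine Finset.sum_congr rfl fun i _ => ?_
    rw [hgram', RLSC.transpose_mulVec_conj_svd hV]
  have hfull : w ⬝ᵥ (Vᵀ *ᵥ y) = RLSC.prediction X x q := by
    rw [hpred]
    exact RLSC.dotProduct_filtered_eq hlam hw' hξ
  refine ⟨by rw [hfull], ?_⟩
  -- With `s ≤ ε/3`, the deviation `2s + s²` of `M` from the identity is at most `2ε/3 + ε²/9 ≤ ε`.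
  have hbound := RLSC.abs_perturbation_le hn hlam hσ hε0.le hMh hM0
    (fun x => RLSC.abs_gram_sub_one_le (by nlinarith) (hM x).1 (hM x).2) hw' hξ hξ'
  rw [← hpred, ← hpred'] at hbound
  have hκ : 0 ≤ RLSC.condNumber σ :=
    div_nonneg (Real.iSup_nonneg hSVD.nonneg) (Real.iInf_nonneg hSVD.nonneg)
  rw [hfull] at hω
  have hεκ : 0 ≤ ε * RLSC.condNumber σ := mul_nonneg hε0.le hκ
  have h1 := mul_nonneg hεκ (mul_nonneg (RLSC.l2norm_nonneg w) (RLSC.l2norm_nonneg (Vᵀ *ᵥ y)))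
  have h2 := mul_le_mul_of_nonneg_left hω hεκ
  calc _ ≤ ε * RLSC.condNumber σ * (RLSC.l2norm w * RLSC.l2norm (Vᵀ *ᵥ y)) := hbound
    -- The estimate already holds without the factor 2. As no sign of `ω` is assumed, nonnegativity
    -- of the right-hand side comes from `h1` and `h2`.
    _ ≤ 2 * (ε * RLSC.condNumber σ * (ω * |RLSC.prediction X x q|)) := by linarith
    _ = _ := by ring
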